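/- \textbf{Theorem.} In $k$-median with outliers one is given a finite set $F$ of candidate medians, a finite family $C$ of points, a (pseudo)metric $d$ on $C\cup F$ with integer values, an integer $k\ge 1$ and an integer $z\ge 0$. A solution is a set $S\subseteq F$ of $k$ medians ($S=F$ if $|F|<k$). With $d(j,S)=\min_{i\in S}d(j,i)$, let $\mathsf{opt}$ be the minimum of $\sum_{j\in C\setminus O}d(j,S)$ over all solutions $S$ and all $O\subseteq C$ with $|O|\le z$. A solution $S$ is a $(\beta,\alpha)$-bicriteria approximation if there is $O\subseteq C$ with $|O|\le\beta z$ and $\sum_{j\in C\setminus O}d(j,S)\le\alpha\cdot\mathsf{opt}$. In the online problem the points $j_1,\dots,j_n$ arrive one at a time, and $k$ and $z$ are known at the start, while $n$ and $d$ are not. In the \emph{static $F$ setting}, $F\neq\emptyset$ is fixed and known at the start, and the distances from $j_t$ to the members of $F$ are revealed when $j_t$ arrives. In the \emph{$F=C$ setting}, the candidate medians at time $t$ are $j_1,\dots,j_t$, and the distances from $j_t$ to $j_1,\dots,j_{t-1}$ are revealed when $j_t$ arrives. After each arrival a deterministic online algorithm computes a set $S_t$ of medians from the information revealed so far. Its total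 recourse is $\sum_{t=1}^{n}|S_t\setminus S_{t-1}|$, where $S_0=\emptyset$. Let $D$ be the diameter of $d$ on the set of all candidate medians and points. There are absolute constants $\beta,\alpha\ge 1$ and $K>0$ such that, in the static $F$ setting and also in the $F=C$ setting, there is a deterministic (computable) online algorithm with the following two properties on every input. First, at every time $t=1,\dots,n$ the set $S_t$ is a $(\beta,\alpha)$-bicriteria approximation for the instance formed by the points that have arrived so far. Second, if $n\ge 2$ and $D>0$, the total recourse is at most $K\,k^2\log n\,\log(nD)$. -/

import Mathlib

namespace KMedOutliers

/-!
Throughout, candidate medians (facilities) and points (clients) are indexed by natural numbers: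
`f i` is the location of the candidate median `i` and `c j` the location of the point `j`.
An instance consists of a finite set `F` of candidate medians and a finite set `C` of points.
-/

section Offline

variable {X : Type*} [PseudoMetricSpace X]

/-- `S` is a set of `k` medians from `F` (all of `F` when fewer than `k` candidates exist). -/
def IsSolution (F : Finset ℕ) (k : ℕ) (S : Finset ℕ) : Prop :=
  S ⊆ F ∧ S.card = min k F.card

/-- Connection cost `∑_{j ∈ C \ O} d(j, S)` of the medians `S` when the points in `O` are removed;
for the finite nonempty sets `S` met here, `Metric.infDist` is the minimum over `S`. -/
noncomputable def cost (f c : ℕ → X) (C O S : Finset ℕ) : ℝ :=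
  ∑ j ∈ C \ O, Metric.infDist (c j) (f '' (S : Set ℕ))

/-- Optimum of the `k`-median instance with at most `z` outliers
(the infimum of a finite nonempty set of nonnegative values). -/
noncomputable def opt (f c : ℕ → X) (F C : Finset ℕ) (k z : ℕ) : ℝ :=
  sInf {v : ℝ | ∃ S O : Finset ℕ, IsSolution F k S ∧ O ⊆ C ∧ O.card ≤ z ∧ v = cost f c C O S}

/-- `S` is a `(β, α)`-bicriteria approximation: `k` medians which, after the removal of at most
`β z` points, cost at most `α` times the optimum with `z` outliers. -/
def IsBicriteria (β α : ℝ) (f c : ℕ → X) (F C : Finset ℕ) (k z : ℕ) (S : Finset ℕ) : Prop :=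
  IsSolution F k S ∧
    ∃ O : Finset ℕ, O ⊆ C ∧ (O.card : ℝ) ≤ β * (z : ℝ) ∧ cost f c C O S ≤ α * opt f c F C k z

end Offline

section Online

variable {X : Type*} [PseudoMetricSpace X]

/-- What has been revealed after `t` arrivals when the `m` candidate medians are fixed in advance:
for each arrived point, the list of its (integral) distances to the candidate medians. -/
noncomputable def staticHistory (f c : ℕ → X) (m t : ℕ) : List (List ℕ) :=
  (List.range t).map fun j => (List.range m).map fun i => ⌊dist (f i) (c j)⌋₊

/-- What has been revealed after `t` arrivals when the candidate medians are the arrived points: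
for each arrived point, the list of its (integral) distances to the points that came before it. -/
noncomputable def dynamicHistory (c : ℕ → X) (t : ℕ) : List (List ℕ) :=
  (List.range t).map fun j => (List.range j).map fun i => ⌊dist (c i) (c j)⌋₊

/-- Total recourse `∑_{t = 1}^{n} |S_t \ S_{t-1}|`. -/
def totalRecourse (S : ℕ → Finset ℕ) (n : ℕ) : ℕ :=
  ∑ t ∈ Finset.range n, (S (t + 1) \ S t).card

/-- The medians kept by the deterministic online algorithm `A` for fixed candidate medians:
none before the first arrival, and from then on what `A` computes from `k`, `z`, `m` and
the information revealed so far. -/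
noncomputable def staticRun (A : ℕ × ℕ × ℕ × List (List ℕ) → List ℕ) (f c : ℕ → X) (k z m t : ℕ) :
    Finset ℕ :=
  if t = 0 then ∅ else (A (k, z, m, staticHistory f c m t)).toFinset

/-- The medians kept by the deterministic online algorithm `A` when the candidate medians are the
arrived points. -/
noncomputable def dynamicRun (A : ℕ × ℕ × List (List ℕ) → List ℕ) (c : ℕ → X) (k z t : ℕ) :
    Finset ℕ :=
  if t = 0 then ∅ else (A (k, z, dynamicHistory c t)).toFinset

end Online

end KMedOutliers

namespace KMedOutliers

/-! ### The algorithm -/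

/-! Truncate distances at `p` and put `g = (8z+1)p/4`. The algorithm holds a set of medians and a
power of two `p`. It doubles `p` until some solution is cheap, that is, has truncated cost at most
`g`. It switches to a cheap solution only if `p` has risen, the number of medians is wrong, or their
truncated cost exceeds `2g`.

Quality (`IsTrace.isBicriteria`): truncated cost at most `2g` leaves at most `4z` points at distance
`p` or more, and the other points cost at most `2g`. If `p > 1`, then at some time so far no
solution was cheap for `p/2`. Since `z` outliers account for at most `zp/2` of a cost truncated at
`p/2`, the optimum is at least of order `(z+1)p`. When `F = C`, that failure concerns the candidates
of the earlier time; a current solution is moved to them with a loss of a factor `2`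
(`exists_isSolution_subset`). If `p = 1`, integrality makes all remaining distances zero.

Recourse: in the phase of a fixed `p`, the truncated cost of the current medians is a potential. A
switch caused by cost lowers it by at least `g`, and only arrivals or a wrong number of medians
raise it (`IsTrace.potential`). Compare with a solution `T` that is cheap at the end of the phase.
If an arriving point has `r` predecessors in its cluster of `T`, averaging over them shows that the
cluster center is within truncated distance `3g/r` of the current medians (`near_le_add_div_rank`).
Summing inverse ranks over at most `k` clusters bounds the increments by `O(g k log n)`, hence the
switches per phase by `O(k log n)`, apart from at most `k` steps with a wrong number of medians.
There are `O(log(nD))` phases, and a switch adds at most `k` medians. -/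

/-- All subsets of `{0, …, m - 1}`, as duplicate-free lists. -/
def subsetLists (m : ℕ) : List (List ℕ) :=
  Nat.rec [[]] (fun i L => L ++ L.map (List.cons i)) m

/-- The distance to the closest of the medians `l`, truncated at `p`,
of a point whose distances to the candidate medians are `row`. -/
def truncDist (p : ℕ) (row l : List ℕ) : ℕ :=
  l.foldl (fun a i => min a (row.getD i 0)) p

/-- The sum of the truncated distances to the medians `l`. -/
def truncCost (p : ℕ) (M : List (List ℕ)) (l : List ℕ) : ℕ :=
  M.foldl (fun s row => s + truncDist p row l) 0

/-- The sum of the distances to the candidate median `0`. -/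
def costZero (M : List (List ℕ)) : ℕ :=
  M.foldl (fun s row => s + row.getD 0 0) 0

/-- The sets of `min k m` medians that are cheap for the truncation `p`. An instance is given by
`(k, z, m, M)` with `M` the matrix of distances from the points to the `m` candidate medians. -/
def cheapSets (q : ℕ × ℕ × ℕ × List (List ℕ)) (p : ℕ) : List (List ℕ) :=
  (subsetLists q.2.2.1).filter fun l =>
    l.length = min q.1 q.2.2.1 ∧ 4 * truncCost p q.2.2.2 l ≤ (8 * q.2.1 + 1) * p

/-- Double the truncation if no set of medians is cheap for it. -/
def raiseOnce (q : ℕ × ℕ × ℕ × List (List ℕ)) (p : ℕ) : ℕ :=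
  if cheapSets q p = [] then 2 * p else p

/-- Double the truncation until some set of medians is cheap for it. -/
def raise (q : ℕ × ℕ × ℕ × List (List ℕ)) (p : ℕ) : ℕ :=
  (raiseOnce q)^[4 * costZero q.2.2.2] p

/-- The current medians `s.1` may be kept under the truncation `s.2`. -/
def Keeps (q : ℕ × ℕ × ℕ × List (List ℕ)) (s : List ℕ × ℕ) : Prop :=
  raise q s.2 = s.2 ∧ s.1.length = min q.1 q.2.2.1 ∧
    4 * truncCost s.2 q.2.2.2 s.1 ≤ (16 * q.2.1 + 2) * s.2

instance (q : ℕ × ℕ × ℕ × List (List ℕ)) (s : List ℕ × ℕ) : Decidable (Keeps q s) := by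
  unfold Keeps; infer_instance

/-- One step of the algorithm, on a state of medians and truncation. -/
def step (q : ℕ × ℕ × ℕ × List (List ℕ)) (s : List ℕ × ℕ) : List ℕ × ℕ :=
  if Keeps q s then s else ((cheapSets q (raise q s.2)).headI, raise q s.2)

/-- The algorithm for fixed candidate medians. -/
def staticState (x : ℕ × ℕ × ℕ × List (List ℕ)) (t : ℕ) : List ℕ × ℕ :=
  Nat.rec ([], 1) (fun t s => step (x.1, x.2.1, x.2.2.1, x.2.2.2.take (t + 1)) s) t

def staticAlg (x : ℕ × ℕ × ℕ × List (List ℕ)) : List ℕ :=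
  (staticState x x.2.2.2.length).1

/-- The full distance matrix of the first `t` points. -/
def symmMatrix (H : List (List ℕ)) (t : ℕ) : List (List ℕ) :=
  (List.range t).map fun j => (List.range t).map fun i =>
    (H.getD j []).getD i 0 + (H.getD i []).getD j 0

/-- The algorithm for candidate medians that are the arrived points. -/
def dynamicState (x : ℕ × ℕ × List (List ℕ)) (t : ℕ) : List ℕ × ℕ :=
  Nat.rec ([], 1) (fun t s => step (x.1, x.2.1, t + 1, symmMatrix x.2.2 (t + 1)) s) t

def dynamicAlg (x : ℕ × ℕ × List (List ℕ)) : List ℕ :=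
  (dynamicState x x.2.2.length).1

/-! ### Computability -/

section Computability

open Primrec

theorem primrec_subsetLists : Primrec subsetLists := by
  have hc : Primrec₂ fun (a : ℕ × List (List ℕ)) (l : List ℕ) => a.1 :: l :=
    Primrec.list_cons.comp (fst.comp fst) snd
  have h : Primrec₂ fun (i : ℕ) (L : List (List ℕ)) => L ++ L.map (List.cons i) :=
    Primrec.list_append.comp snd (Primrec.list_map snd hc)
  exact Primrec.nat_rec₁ [[]] h

theorem primrec_truncDist : Primrec fun a : ℕ × List ℕ × List ℕ => truncDist a.1 a.2.1 a.2.2 := by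
  have h : Primrec₂ fun (a : ℕ × List ℕ × List ℕ) (b : ℕ × ℕ) => min b.1 (a.2.1.getD b.2 0) :=
    Primrec.nat_min.comp (fst.comp snd)
      ((Primrec.list_getD 0).comp (fst.comp (snd.comp fst)) (snd.comp snd))
  exact Primrec.list_foldl (snd.comp snd) fst h

theorem primrec_truncCost :
    Primrec fun a : ℕ × List (List ℕ) × List ℕ => truncCost a.1 a.2.1 a.2.2 := by
  have h : Primrec₂ fun (a : ℕ × List (List ℕ) × List ℕ) (b : ℕ × List ℕ) =>
      b.1 + truncDist a.1 b.2 a.2.2 :=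
    Primrec.nat_add.comp (fst.comp snd) (primrec_truncDist.comp
      (Primrec.pair (fst.comp fst) (Primrec.pair (snd.comp snd) (snd.comp (snd.comp fst)))))
  exact Primrec.list_foldl (fst.comp snd) (.const 0) h

theorem primrec_costZero : Primrec costZero := by
  have h : Primrec₂ fun (_ : List (List ℕ)) (b : ℕ × List ℕ) => b.1 + b.2.getD 0 0 :=
    Primrec.nat_add.comp (fst.comp snd) ((Primrec.list_getD 0).comp (snd.comp snd) (.const 0))
  exact Primrec.list_foldl .id (.const 0) h

theorem primrec_const_mul {α : Type*} [Primcodable α] {f : α → ℕ} (a : ℕ) (hf : Primrec f) :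
    Primrec fun x => a * f x :=
  Primrec.nat_mul.comp (.const a) hf

theorem primrec_mul_add_mul {α : Type*} [Primcodable α] {f g : α → ℕ} (a b : ℕ)
    (hf : Primrec f) (hg : Primrec g) : Primrec fun x => (a * f x + b) * g x :=
  Primrec.nat_mul.comp (Primrec.nat_add.comp (Primrec.nat_mul.comp (.const a) hf) (.const b)) hg

theorem primrec_cheapSets : Primrec₂ cheapSets := by
  have hq : Primrec fun b : List ℕ × ((ℕ × ℕ × ℕ × List (List ℕ)) × ℕ) => b.2.1 :=
    fst.comp snd
  have hp : Primrec fun b : List ℕ × ((ℕ × ℕ × ℕ × List (List ℕ)) × ℕ) => b.2.2 :=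
    snd.comp snd
  have hc : Primrec fun b : List ℕ × ((ℕ × ℕ × ℕ × List (List ℕ)) × ℕ) =>
      truncCost b.2.2 b.2.1.2.2.2 b.1 :=
    primrec_truncCost.comp (Primrec.pair hp (Primrec.pair (snd.comp (snd.comp (snd.comp hq))) fst))
  have h₁ : PrimrecPred fun b : List ℕ × ((ℕ × ℕ × ℕ × List (List ℕ)) × ℕ) =>
      b.1.length = min b.2.1.1 b.2.1.2.2.1 :=
    Primrec.eq.comp (Primrec.list_length.comp fst)
      (Primrec.nat_min.comp (fst.comp hq) (fst.comp (snd.comp (snd.comp hq))))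
  have h₂ : PrimrecPred fun b : List ℕ × ((ℕ × ℕ × ℕ × List (List ℕ)) × ℕ) =>
      4 * truncCost b.2.2 b.2.1.2.2.2 b.1 ≤ (8 * b.2.1.2.1 + 1) * b.2.2 :=
    Primrec.nat_le.comp (primrec_const_mul 4 hc)
      (primrec_mul_add_mul 8 1 (fst.comp (snd.comp hq)) hp)
  have hR : PrimrecRel fun (l : List ℕ) (a : (ℕ × ℕ × ℕ × List (List ℕ)) × ℕ) =>
      l.length = min a.1.1 a.1.2.2.1 ∧
        4 * truncCost a.2 a.1.2.2.2 l ≤ (8 * a.1.2.1 + 1) * a.2 :=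
    (h₁.and h₂).primrecRel
  exact (PrimrecRel.listFilter hR).comp
    (primrec_subsetLists.comp (fst.comp (snd.comp (snd.comp fst)))) .id

theorem primrec_raiseOnce : Primrec₂ raiseOnce := by
  have h : PrimrecPred fun a : (ℕ × ℕ × ℕ × List (List ℕ)) × ℕ => cheapSets a.1 a.2 = [] :=
    Primrec.eq.comp primrec_cheapSets (.const [])
  unfold raiseOnce Primrec₂
  exact Primrec.ite h (primrec_const_mul 2 snd) snd

theorem primrec_raise : Primrec₂ raise := by
  have h : Primrec₂ fun (a : (ℕ × ℕ × ℕ × List (List ℕ)) × ℕ) (p : ℕ) => raiseOnce a.1 p :=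
    primrec_raiseOnce.comp (fst.comp fst) snd
  have hM : Primrec fun a : (ℕ × ℕ × ℕ × List (List ℕ)) × ℕ => a.1.2.2.2 :=
    snd.comp (snd.comp (snd.comp fst))
  have hZ : Primrec fun a : (ℕ × ℕ × ℕ × List (List ℕ)) × ℕ => costZero a.1.2.2.2 :=
    primrec_costZero.comp hM
  have hN : Primrec fun a : (ℕ × ℕ × ℕ × List (List ℕ)) × ℕ => 4 * costZero a.1.2.2.2 :=
    primrec_const_mul 4 hZ
  unfold raise Primrec₂
  exact Primrec.nat_iterate hN snd h

theorem primrec_step : Primrec₂ step := by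
  have hp : Primrec fun a : (ℕ × ℕ × ℕ × List (List ℕ)) × (List ℕ × ℕ) => a.2.2 := snd.comp snd
  have hr : Primrec fun a : (ℕ × ℕ × ℕ × List (List ℕ)) × (List ℕ × ℕ) => raise a.1 a.2.2 :=
    primrec_raise.comp fst hp
  have hs : Primrec fun a : (ℕ × ℕ × ℕ × List (List ℕ)) × (List ℕ × ℕ) =>
      ((cheapSets a.1 (raise a.1 a.2.2)).headI, raise a.1 a.2.2) :=
    Primrec.pair (Primrec.list_headI.comp (primrec_cheapSets.comp fst hr)) hr
  have hc : Primrec fun a : (ℕ × ℕ × ℕ × List (List ℕ)) × (List ℕ × ℕ) =>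
      truncCost a.2.2 a.1.2.2.2 a.2.1 :=
    primrec_truncCost.comp
      (Primrec.pair hp (Primrec.pair (snd.comp (snd.comp (snd.comp fst))) (fst.comp snd)))
  have h₁ : PrimrecPred fun a : (ℕ × ℕ × ℕ × List (List ℕ)) × (List ℕ × ℕ) =>
      raise a.1 a.2.2 = a.2.2 := Primrec.eq.comp hr hp
  have h₂ : PrimrecPred fun a : (ℕ × ℕ × ℕ × List (List ℕ)) × (List ℕ × ℕ) =>
      a.2.1.length = min a.1.1 a.1.2.2.1 :=
    Primrec.eq.comp (Primrec.list_length.comp (fst.comp snd))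
      (Primrec.nat_min.comp (fst.comp fst) (fst.comp (snd.comp (snd.comp fst))))
  have h₃ : PrimrecPred fun a : (ℕ × ℕ × ℕ × List (List ℕ)) × (List ℕ × ℕ) =>
      4 * truncCost a.2.2 a.1.2.2.2 a.2.1 ≤ (16 * a.1.2.1 + 2) * a.2.2 :=
    Primrec.nat_le.comp (primrec_const_mul 4 hc)
      (primrec_mul_add_mul 16 2 (fst.comp (snd.comp fst)) hp)
  have hk : PrimrecPred fun a : (ℕ × ℕ × ℕ × List (List ℕ)) × (List ℕ × ℕ) => Keeps a.1 a.2 :=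
    h₁.and (h₂.and h₃)
  unfold step Primrec₂
  exact Primrec.ite hk snd hs

theorem primrec_staticAlg : Primrec staticAlg := by
  have h : Primrec₂ fun (x : ℕ × ℕ × ℕ × List (List ℕ)) (b : ℕ × (List ℕ × ℕ)) =>
      step (x.1, x.2.1, x.2.2.1, x.2.2.2.take (b.1 + 1)) b.2 :=
    primrec_step.comp (Primrec.pair (fst.comp fst) (Primrec.pair
      (fst.comp (snd.comp fst)) (Primrec.pair (fst.comp (snd.comp (snd.comp fst)))
        (Primrec.list_take.comp (Primrec.succ.comp (fst.comp snd))
          (snd.comp (snd.comp (snd.comp fst))))))) (snd.comp snd)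
  have h' : Primrec fun x : ℕ × ℕ × ℕ × List (List ℕ) => staticState x x.2.2.2.length :=
    Primrec.nat_rec' (Primrec.list_length.comp (snd.comp (snd.comp snd))) (.const ([], 1)) h
  exact fst.comp h'

theorem primrec_symmMatrix : Primrec₂ symmMatrix := by
  have hH : Primrec fun a : ((List (List ℕ) × ℕ) × ℕ) × ℕ => a.1.1.1 := fst.comp (fst.comp fst)
  have hj : Primrec fun a : ((List (List ℕ) × ℕ) × ℕ) × ℕ => a.1.2 := snd.comp fst
  have h : Primrec₂ fun (a : (List (List ℕ) × ℕ) × ℕ) (i : ℕ) =>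
      (a.1.1.getD a.2 []).getD i 0 + (a.1.1.getD i []).getD a.2 0 :=
    Primrec.nat_add.comp
      ((Primrec.list_getD 0).comp ((Primrec.list_getD []).comp hH hj) snd)
      ((Primrec.list_getD 0).comp ((Primrec.list_getD []).comp hH snd) hj)
  have h' : Primrec₂ fun (a : List (List ℕ) × ℕ) (j : ℕ) => (List.range a.2).map fun i =>
      (a.1.getD j []).getD i 0 + (a.1.getD i []).getD j 0 :=
    Primrec.list_map (Primrec.list_range.comp (snd.comp fst)) h
  exact Primrec.list_map (Primrec.list_range.comp snd) h'

theorem primrec_dynamicAlg : Primrec dynamicAlg := by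
  have ht : Primrec fun a : (ℕ × ℕ × List (List ℕ)) × (ℕ × (List ℕ × ℕ)) => a.2.1 + 1 :=
    Primrec.succ.comp (fst.comp snd)
  have h : Primrec₂ fun (x : ℕ × ℕ × List (List ℕ)) (b : ℕ × (List ℕ × ℕ)) =>
      step (x.1, x.2.1, b.1 + 1, symmMatrix x.2.2 (b.1 + 1)) b.2 :=
    primrec_step.comp (Primrec.pair (fst.comp fst) (Primrec.pair
      (fst.comp (snd.comp fst)) (Primrec.pair ht
        (primrec_symmMatrix.comp (snd.comp (snd.comp fst)) ht)))) (snd.comp snd)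
  have h' : Primrec fun x : ℕ × ℕ × List (List ℕ) => dynamicState x x.2.2.length :=
    Primrec.nat_rec' (Primrec.list_length.comp (snd.comp snd)) (.const ([], 1)) h
  exact fst.comp h'

end Computability

/-! ### Folds, subset enumeration and iterated doubling -/

section Lists

theorem foldl_min_le (g : ℕ → ℕ) (l : List ℕ) (a : ℕ) :
    l.foldl (fun a i => min a (g i)) a ≤ a ∧ ∀ i ∈ l, l.foldl (fun a i => min a (g i)) a ≤ g i := by
  induction l generalizing a with
  | nil => simp
  | cons b l ih =>
    obtain ⟨h₁, h₂⟩ := ih (min a (g b))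
    simp only [List.foldl_cons, List.mem_cons, forall_eq_or_imp]
    exact ⟨h₁.trans (min_le_left _ _), h₁.trans (min_le_right _ _), h₂⟩

theorem foldl_min_eq (g : ℕ → ℕ) (l : List ℕ) (a : ℕ) :
    l.foldl (fun a i => min a (g i)) a = a ∨
      ∃ i ∈ l, l.foldl (fun a i => min a (g i)) a = g i := by
  induction l generalizing a with
  | nil => simp
  | cons b l ih =>
    simp only [List.foldl_cons, List.mem_cons, exists_eq_or_imp]
    rcases ih (min a (g b)) with h | h
    · rcases min_choice a (g b) with h' | h' <;> rw [h'] at h ⊢ <;> simp [h]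
    · exact .inr (.inr h)

theorem foldl_add_map_range {α : Type*} (g : α → ℕ) (r : ℕ → α) (t : ℕ) :
    ((List.range t).map r).foldl (fun s x => s + g x) 0 = ∑ j ∈ Finset.range t, g (r j) := by
  induction t with
  | zero => simp
  | succ t ih => rw [List.range_succ, List.map_append, List.foldl_append, ih,
      Finset.sum_range_succ]; simp

theorem mem_subsetLists_succ {m : ℕ} {l : List ℕ} : l ∈ subsetLists (m + 1) ↔
    l ∈ subsetLists m ∨ ∃ l' ∈ subsetLists m, m :: l' = l := by
  change l ∈ subsetLists m ++ (subsetLists m).map (List.cons m) ↔ _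
  simp

theorem nodup_of_mem_subsetLists {m : ℕ} {l : List ℕ} (h : l ∈ subsetLists m) :
    l.Nodup ∧ ∀ i ∈ l, i < m := by
  induction m generalizing l with
  | zero =>
    have : l = [] := by simpa [subsetLists] using h
    simp [this]
  | succ m ih =>
    rcases mem_subsetLists_succ.1 h with h | ⟨l', h', rfl⟩
    · exact ⟨(ih h).1, fun i hi => ((ih h).2 i hi).trans (Nat.lt_succ_self m)⟩
    · obtain ⟨h₁, h₂⟩ := ih h'
      refine ⟨List.nodup_cons.2 ⟨fun hm => (h₂ m hm).false, h₁⟩, fun i hi => ?_⟩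
      rcases List.mem_cons.1 hi with rfl | hi
      · exact Nat.lt_succ_self _
      · exact (h₂ i hi).trans (Nat.lt_succ_self m)

theorem exists_mem_subsetLists {m : ℕ} {S : Finset ℕ} (h : S ⊆ Finset.range m) :
    ∃ l ∈ subsetLists m, l.toFinset = S := by
  induction m generalizing S with
  | zero =>
    exact ⟨[], by simp [subsetLists], by simpa [eq_comm] using h⟩
  | succ m ih =>
    obtain ⟨l, hl, hlS⟩ := ih (S := S.erase m) fun i hi => by
      have := h (Finset.mem_of_mem_erase hi)
      have := Finset.ne_of_mem_erase hi
      simp only [Finset.mem_range] at *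
      omega
    by_cases hm : m ∈ S
    · refine ⟨m :: l, mem_subsetLists_succ.2 (.inr ⟨l, hl, rfl⟩), ?_⟩
      rw [List.toFinset_cons, hlS, Finset.insert_erase hm]
    · exact ⟨l, mem_subsetLists_succ.2 (.inl hl), by rw [hlS, Finset.erase_eq_of_notMem hm]⟩

theorem truncDist_le_left (p : ℕ) (row l : List ℕ) : truncDist p row l ≤ p :=
  (foldl_min_le (fun i => row.getD i 0) l p).1

theorem truncDist_le_getD (p : ℕ) (row : List ℕ) {l : List ℕ} {i : ℕ} (hi : i ∈ l) :
    truncDist p row l ≤ row.getD i 0 :=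
  (foldl_min_le (fun i => row.getD i 0) l p).2 i hi

theorem truncDist_eq (p : ℕ) (row l : List ℕ) :
    truncDist p row l = p ∨ ∃ i ∈ l, truncDist p row l = row.getD i 0 :=
  foldl_min_eq (fun i => row.getD i 0) l p

/-- Doubling stops at the first truncation with a cheap set. So after any number of rounds either
such a set exists or every round doubled; and if any round doubled, the value before the last
doubling had no cheap set. The latter is the source of the lower bound on the optimum. -/
theorem raise_spec {q : ℕ × ℕ × ℕ × List (List ℕ)} (p : ℕ) (N : ℕ) :
    (cheapSets q ((raiseOnce q)^[N] p) ≠ [] ∨ (raiseOnce q)^[N] p = 2 ^ N * p) ∧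
      ((raiseOnce q)^[N] p = p ∨
        ∃ a, (raiseOnce q)^[N] p = 2 ^ (a + 1) * p ∧ cheapSets q (2 ^ a * p) = []) := by
  induction N with
  | zero => simp
  | succ N ih =>
    rw [Function.iterate_succ', Function.comp]
    generalize (raiseOnce q)^[N] p = r at ih ⊢
    unfold raiseOnce
    split_ifs with hr
    · obtain ⟨h₁, h₂⟩ := ih
      have h₁ : r = 2 ^ N * p := by tauto
      refine ⟨.inr (by rw [h₁]; ring), .inr ⟨N, by rw [h₁]; ring, by rwa [← h₁]⟩⟩
    · exact ⟨.inl hr, ih.2⟩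

end Lists

/-! ### Truncated distances and their integer encodings -/

section Metric

variable {X : Type*} [PseudoMetricSpace X]

/-- The distance from `x` to the medians `S`, truncated at `p`. -/
noncomputable def near (f : ℕ → X) (p : ℕ) (S : Finset ℕ) (x : X) : ℝ :=
  min (p : ℝ) (Metric.infDist x (f '' (S : Set ℕ)))

theorem near_nonneg (f : ℕ → X) (p : ℕ) (S : Finset ℕ) (x : X) : 0 ≤ near f p S x :=
  le_min (Nat.cast_nonneg p) Metric.infDist_nonneg

theorem near_le_trunc (f : ℕ → X) (p : ℕ) (S : Finset ℕ) (x : X) : near f p S x ≤ p :=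
  min_le_left _ _

theorem near_le_infDist (f : ℕ → X) (p : ℕ) (S : Finset ℕ) (x : X) :
    near f p S x ≤ Metric.infDist x (f '' (S : Set ℕ)) :=
  min_le_right _ _

theorem near_le_near_add (f : ℕ → X) (p : ℕ) (S : Finset ℕ) (x y : X) :
    near f p S x ≤ min (p : ℝ) (dist x y) + near f p S y := by
  unfold near
  have h := Metric.infDist_le_infDist_add_dist (s := f '' (S : Set ℕ)) (x := x) (y := y)
  have := Metric.infDist_nonneg (s := f '' (S : Set ℕ)) (x := y)
  have := dist_nonneg (x := x) (y := y)
  have : (0 : ℝ) ≤ p := Nat.cast_nonneg p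
  rcases min_cases (p : ℝ) (Metric.infDist x (f '' (S : Set ℕ))) with h₁ | h₁ <;>
  rcases min_cases (p : ℝ) (dist x y) with h₂ | h₂ <;>
  rcases min_cases (p : ℝ) (Metric.infDist y (f '' (S : Set ℕ))) with h₃ | h₃ <;> linarith

theorem exists_infDist_eq (f : ℕ → X) {S : Finset ℕ} (hS : S.Nonempty) (x : X) :
    ∃ i ∈ S, Metric.infDist x (f '' (S : Set ℕ)) = dist x (f i) := by
  obtain ⟨y, ⟨i, hi, rfl⟩, h⟩ :=
    ((S.finite_toSet.image f).isCompact).exists_infDist_eq_dist (hS.to_set.image f) x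
  exact ⟨i, hi, h⟩

theorem infDist_le_of_mem (f : ℕ → X) {S : Finset ℕ} {i : ℕ} (hi : i ∈ S) (x : X) :
    Metric.infDist x (f '' (S : Set ℕ)) ≤ dist x (f i) :=
  Metric.infDist_le_dist_of_mem ⟨i, hi, rfl⟩

theorem IsSolution.nonempty {m k : ℕ} {S : Finset ℕ} (h : IsSolution (Finset.range m) k S)
    (hk : 1 ≤ k) (hm : 1 ≤ m) : S.Nonempty := by
  rw [← Finset.card_pos, h.2, Finset.card_range]
  omega

theorem card_le_of_isSolution {F : Finset ℕ} {k : ℕ} {S : Finset ℕ} (h : IsSolution F k S) :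
    S.card ≤ k :=
  h.2.trans_le (min_le_left _ _)

theorem isSolution_range (k m : ℕ) : IsSolution (Finset.range m) k (Finset.range (min k m)) :=
  ⟨Finset.range_mono (min_le_right _ _), by simp⟩

theorem sum_near_range_le {k m t p : ℕ} (f c : ℕ → X) (hk : 1 ≤ k) (hm : 1 ≤ m) :
    ∑ j ∈ Finset.range t, near f p (Finset.range (min k m)) (c j) ≤
      ∑ j ∈ Finset.range t, dist (c j) (f 0) :=
  Finset.sum_le_sum fun j _ => (near_le_infDist _ _ _ _).trans
    (infDist_le_of_mem f (Finset.mem_range.2 (by omega)) (c j))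

section Integral

variable (hX : ∀ x y : X, ∃ a : ℕ, dist x y = (a : ℝ))
include hX

theorem cast_floor_dist (x y : X) : ((⌊dist x y⌋₊ : ℕ) : ℝ) = dist x y := by
  obtain ⟨a, ha⟩ := hX x y
  rw [ha, Nat.floor_natCast]

theorem cast_getD_row (f : ℕ → X) {m i : ℕ} (hi : i < m) (x : X) :
    ((((List.range m).map fun i => ⌊dist (f i) x⌋₊).getD i 0 : ℕ) : ℝ) = dist x (f i) := by
  rw [List.getD_eq_getElem _ _ (by simpa using hi)]
  simp [cast_floor_dist hX, dist_comm]

/-- Nonemptiness matters: the fold over `[]` returns `p`, while `Metric.infDist` to the empty set is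
`0`. -/
theorem cast_truncDist (f : ℕ → X) {m : ℕ} (p : ℕ) {l : List ℕ} (hl : ∀ i ∈ l, i < m)
    (hl₀ : l ≠ []) (x : X) :
    (truncDist p ((List.range m).map fun i => ⌊dist (f i) x⌋₊) l : ℝ) =
      near f p l.toFinset x := by
  have hne : l.toFinset.Nonempty := by simpa using hl₀
  apply le_antisymm
  · obtain ⟨i, hi, h⟩ := exists_infDist_eq f hne x
    refine le_min (Nat.cast_le.2 (truncDist_le_left _ _ _)) ?_
    rw [h, ← cast_getD_row hX f (hl i (by simpa using hi))]
    exact Nat.cast_le.2 (truncDist_le_getD _ _ (by simpa using hi))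
  · rcases truncDist_eq p ((List.range m).map fun i => ⌊dist (f i) x⌋₊) l with h | ⟨i, hi, h⟩
    · rw [h]; exact near_le_trunc _ _ _ _
    · rw [h, cast_getD_row hX f (hl i hi)]
      exact (near_le_infDist _ _ _ _).trans (infDist_le_of_mem f (by simpa using hi) x)

theorem cast_truncCost (f c : ℕ → X) {m : ℕ} (t p : ℕ) {l : List ℕ} (hl : ∀ i ∈ l, i < m)
    (hl₀ : l ≠ []) : (truncCost p (staticHistory f c m t) l : ℝ) =
      ∑ j ∈ Finset.range t, near f p l.toFinset (c j) := by
  rw [truncCost, staticHistory, foldl_add_map_range (fun row => truncDist p row l), Nat.cast_sum]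
  exact Finset.sum_congr rfl fun j _ => cast_truncDist hX f p hl hl₀ (c j)

theorem cast_costZero (f c : ℕ → X) {m : ℕ} (t : ℕ) (hm : 1 ≤ m) :
    (costZero (staticHistory f c m t) : ℝ) = ∑ j ∈ Finset.range t, dist (c j) (f 0) := by
  rw [costZero, staticHistory, foldl_add_map_range (fun row : List ℕ => row.getD 0 0), Nat.cast_sum]
  exact Finset.sum_congr rfl fun j _ => cast_getD_row hX f hm (c j)

variable {k z m t p : ℕ} (f c : ℕ → X)

theorem of_mem_cheapSets (hk : 1 ≤ k) (hm : 1 ≤ m) {l : List ℕ}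
    (h : l ∈ cheapSets (k, z, m, staticHistory f c m t) p) :
    l.Nodup ∧ (∀ i ∈ l, i < m) ∧ l.length = min k m ∧
      4 * ∑ j ∈ Finset.range t, near f p l.toFinset (c j) ≤ (8 * z + 1) * p := by
  simp only [cheapSets, List.mem_filter, decide_eq_true_eq] at h
  obtain ⟨h₁, h₂⟩ := nodup_of_mem_subsetLists h.1
  have hl₀ : l ≠ [] := by rintro rfl; have := h.2.1; simp at this; omega
  refine ⟨h₁, h₂, h.2.1, ?_⟩
  rw [← cast_truncCost hX f c t p h₂ hl₀]
  exact_mod_cast h.2.2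

theorem cheapSets_ne_nil (hk : 1 ≤ k) (hm : 1 ≤ m) {S : Finset ℕ}
    (hS : IsSolution (Finset.range m) k S)
    (h : 4 * ∑ j ∈ Finset.range t, near f p S (c j) ≤ (8 * z + 1) * p) :
    cheapSets (k, z, m, staticHistory f c m t) p ≠ [] := by
  obtain ⟨l, hl, rfl⟩ := exists_mem_subsetLists hS.1
  obtain ⟨h₁, h₂⟩ := nodup_of_mem_subsetLists hl
  have hl₀ : l ≠ [] := by simpa using hS.nonempty hk hm
  refine List.ne_nil_of_mem (a := l) ?_
  simp only [cheapSets, List.mem_filter, decide_eq_true_eq]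
  rw [← cast_truncCost hX f c t p h₂ hl₀] at h
  refine ⟨hl, ?_, by exact_mod_cast h⟩
  rw [← List.toFinset_card_of_nodup h₁, hS.2, Finset.card_range]

/-- The iteration count in `raise` suffices: if all `N = 4 * costZero` rounds double, the truncation
is at least `2 ^ N ≥ N`, and then any solution containing candidate `0` is cheap. -/
theorem cheapSets_raise_ne_nil (hk : 1 ≤ k) (hm : 1 ≤ m) (hp : 1 ≤ p) :
    cheapSets (k, z, m, staticHistory f c m t)
      (raise (k, z, m, staticHistory f c m t) p) ≠ [] := by
  set q := (k, z, m, staticHistory f c m t) with hq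
  rcases (raise_spec (q := q) p (4 * costZero q.2.2.2)).1 with h | h
  · exact h
  · refine cheapSets_ne_nil hX f c hk hm (isSolution_range k m) ?_
    have h₁ := sum_near_range_le (t := t) (p := raise q p) f c hk hm
    rw [← cast_costZero hX f c t hm] at h₁
    have h₂ : 4 * costZero (staticHistory f c m t) ≤ raise q p := by
      rw [raise, h]
      exact (Nat.lt_two_pow_self.le).trans (Nat.le_mul_of_pos_right _ hp)
    have h₃ : (4 * costZero (staticHistory f c m t) : ℝ) ≤ raise q p := by exact_mod_cast h₂
    have : (0 : ℝ) ≤ z * raise q p := by positivity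
    nlinarith

end Integral

end Metric

/-! ### Invariants of a run, common to both settings -/

section Trace

variable {X : Type*} [PseudoMetricSpace X]

/-- The states of the algorithm when the candidate medians at time `t` are `0, …, mm t - 1`. -/
noncomputable def runState (f c : ℕ → X) (k z : ℕ) (mm : ℕ → ℕ) (t : ℕ) : List ℕ × ℕ :=
  Nat.rec ([], 1) (fun t s => step (k, z, mm (t + 1), staticHistory f c (mm (t + 1)) (t + 1)) s) t

/-- What the analysis needs to know about the medians `S t` and truncations `p t` computed by the
algorithm. -/
structure IsTrace (f c : ℕ → X) (k z : ℕ) (mm : ℕ → ℕ) (S : ℕ → Finset ℕ) (p : ℕ → ℕ) : Prop where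
  isSolution (t : ℕ) : IsSolution (Finset.range (mm (t + 1))) k (S (t + 1))
  cost_le (t : ℕ) : 4 * ∑ j ∈ Finset.range (t + 1), near f (p (t + 1)) (S (t + 1)) (c j) ≤
    (16 * z + 2) * p (t + 1)
  exists_cheap (t : ℕ) : ∃ T, IsSolution (Finset.range (mm (t + 1))) k T ∧
    4 * ∑ j ∈ Finset.range (t + 1), near f (p (t + 1)) T (c j) ≤ (8 * z + 1) * p (t + 1)
  trunc_mono : Monotone p
  keep_or (t : ℕ) : (S (t + 1) = S t ∧ p (t + 1) = p t) ∨
    (4 * ∑ j ∈ Finset.range (t + 1), near f (p (t + 1)) (S (t + 1)) (c j) ≤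
      (8 * z + 1) * p (t + 1) ∧ (p (t + 1) ≠ p t ∨ (S t).card ≠ min k (mm (t + 1)) ∨
        (16 * z + 2) * p t < 4 * ∑ j ∈ Finset.range (t + 1), near f (p t) (S t) (c j)))
  trunc_eq (t : ℕ) : ∃ i, p t = 2 ^ i ∧ (i = 0 ∨ ∃ a i', i = i' + 1 ∧ a < t ∧
    ∀ T, IsSolution (Finset.range (mm (a + 1))) k T →
      (8 * z + 1) * (2 ^ i' : ℕ) < 4 * ∑ j ∈ Finset.range (a + 1), near f (2 ^ i') T (c j))

theorem runState_succ (f c : ℕ → X) (k z : ℕ) (mm : ℕ → ℕ) (t : ℕ) :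
    runState f c k z mm (t + 1) = step (k, z, mm (t + 1),
      staticHistory f c (mm (t + 1)) (t + 1)) (runState f c k z mm t) := rfl

theorem isTrace_runState (hX : ∀ x y : X, ∃ a : ℕ, dist x y = (a : ℝ)) (f c : ℕ → X)
    {k : ℕ} (z : ℕ) {mm : ℕ → ℕ} (hk : 1 ≤ k) (hmm : Monotone mm) (hm : ∀ t, 1 ≤ mm (t + 1)) :
    IsTrace f c k z mm (fun t => (runState f c k z mm t).1.toFinset)
      (fun t => (runState f c k z mm t).2) := by
  set s := runState f c k z mm with hs
  have hraise (t : ℕ) : (s (t + 1)).2 = raise (k, z, mm (t + 1),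
      staticHistory f c (mm (t + 1)) (t + 1)) (s t).2 := by
    rw [hs, runState_succ, step]
    split_ifs with h
    · exact h.1.symm
    · rfl
  have hle (t : ℕ) : (s t).2 ≤ (s (t + 1)).2 := by
    rw [hraise, raise]
    rcases (raise_spec (q := (k, z, mm (t + 1), staticHistory f c (mm (t + 1)) (t + 1)))
      (s t).2 (4 * costZero (staticHistory f c (mm (t + 1)) (t + 1)))).2 with h | ⟨a, h, -⟩ <;>
      simp only [h]
    · exact le_rfl
    · exact Nat.le_mul_of_pos_left _ (by positivity)
  have hmono : Monotone fun t => (s t).2 := monotone_nat_of_le_succ hle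
  have hpos (t : ℕ) : 1 ≤ (s t).2 := hmono (Nat.zero_le t)
  have hcheap (t : ℕ) : cheapSets (k, z, mm (t + 1), staticHistory f c (mm (t + 1)) (t + 1))
      (s (t + 1)).2 ≠ [] := by
    rw [hraise]
    exact cheapSets_raise_ne_nil hX f c hk (hm t) (hpos t)
  have hhead (t : ℕ) : (cheapSets (k, z, mm (t + 1), staticHistory f c (mm (t + 1)) (t + 1))
      (s (t + 1)).2).headI ∈ cheapSets (k, z, mm (t + 1), staticHistory f c (mm (t + 1)) (t + 1))
      (s (t + 1)).2 := by
    obtain ⟨l, L, h⟩ := List.exists_cons_of_ne_nil (hcheap t)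
    simp [h]
  have hstep (t : ℕ) : (Keeps (k, z, mm (t + 1), staticHistory f c (mm (t + 1)) (t + 1)) (s t) ∧
      s (t + 1) = s t) ∨
      (¬ Keeps (k, z, mm (t + 1), staticHistory f c (mm (t + 1)) (t + 1)) (s t) ∧
        (s (t + 1)).1 ∈ cheapSets (k, z, mm (t + 1), staticHistory f c (mm (t + 1)) (t + 1))
          (s (t + 1)).2) := by
    by_cases h : Keeps (k, z, mm (t + 1), staticHistory f c (mm (t + 1)) (t + 1)) (s t)
    · exact .inl ⟨h, by rw [hs, runState_succ, step, if_pos h]⟩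
    · refine .inr ⟨h, ?_⟩
      have : (s (t + 1)).1 = (cheapSets (k, z, mm (t + 1),
          staticHistory f c (mm (t + 1)) (t + 1)) (s (t + 1)).2).headI := by
        rw [hraise, hs, runState_succ, step, if_neg h]
      rw [this]
      exact hhead t
  have hbound (t : ℕ) : (s t).1.Nodup ∧ ∀ i ∈ (s t).1, i < mm t := by
    induction t with
    | zero => simp [hs, runState]
    | succ t ih =>
      rcases hstep t with ⟨-, h⟩ | ⟨-, h⟩
      · rw [h]; exact ⟨ih.1, fun i hi => (ih.2 i hi).trans_le (hmm (Nat.le_succ t))⟩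
      · obtain ⟨h₁, h₂, -⟩ := of_mem_cheapSets hX f c hk (hm t) h
        exact ⟨h₁, h₂⟩
  have hlen (t : ℕ) : (s (t + 1)).1.length = min k (mm (t + 1)) := by
    rcases hstep t with ⟨h, h'⟩ | ⟨-, h⟩
    · rw [h']; exact h.2.1
    · exact (of_mem_cheapSets hX f c hk (hm t) h).2.2.1
  have hcast (t : ℕ) (h : (s t).1.length = min k (mm (t + 1))) :
      (truncCost (s t).2 (staticHistory f c (mm (t + 1)) (t + 1)) (s t).1 : ℝ) =
        ∑ j ∈ Finset.range (t + 1), near f (s t).2 (s t).1.toFinset (c j) := by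
    refine cast_truncCost hX f c (t + 1) (s t).2
      (fun i hi => ((hbound t).2 i hi).trans_le (hmm (Nat.le_succ t))) fun h₀ => ?_
    have := hm t
    rw [h₀, List.length_nil] at h
    omega
  have hz : (0 : ℝ) ≤ z := Nat.cast_nonneg z
  refine ⟨fun t => ⟨fun i hi => ?_, ?_⟩, fun t => ?_, fun t => ?_, hmono,
    fun t => ?_, fun t => ?_⟩
  · exact Finset.mem_range.2 ((hbound (t + 1)).2 i (by simpa using hi))
  · rw [List.toFinset_card_of_nodup (hbound (t + 1)).1, hlen, Finset.card_range]
  · rcases hstep t with ⟨h, h'⟩ | ⟨-, h⟩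
    · simp only [h']
      rw [← hcast t h.2.1]
      exact_mod_cast h.2.2
    · have := (of_mem_cheapSets hX f c hk (hm t) h).2.2.2
      have hp : (0 : ℝ) ≤ (s (t + 1)).2 := Nat.cast_nonneg _
      nlinarith
  · obtain ⟨h₁, h₂, h₃, h₄⟩ := of_mem_cheapSets hX f c hk (hm t) (hhead t)
    refine ⟨_, ⟨fun i hi => ?_, ?_⟩, h₄⟩
    · exact Finset.mem_range.2 (h₂ i (by simpa using hi))
    · rw [List.toFinset_card_of_nodup h₁, h₃, Finset.card_range]
  · rcases hstep t with ⟨-, h⟩ | ⟨hk', h⟩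
    · exact .inl (by simp [h])
    · refine .inr ⟨(of_mem_cheapSets hX f c hk (hm t) h).2.2.2, ?_⟩
      by_contra! hcon
      obtain ⟨h₁, h₂, h₃⟩ := hcon
      rw [List.toFinset_card_of_nodup (hbound t).1] at h₂
      refine hk' ⟨(hraise t).symm.trans h₁, h₂, ?_⟩
      rw [← hcast t h₂] at h₃
      exact_mod_cast h₃
  · induction t with
    | zero => exact ⟨0, by simp [hs, runState]⟩
    | succ t ih =>
      have hr := hraise t
      rw [raise] at hr
      rcases (raise_spec (q := (k, z, mm (t + 1), staticHistory f c (mm (t + 1)) (t + 1)))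
        (s t).2 (4 * costZero (staticHistory f c (mm (t + 1)) (t + 1)))).2 with h | ⟨a, h, h'⟩
      · obtain ⟨i, hi, hi'⟩ := ih
        refine ⟨i, by rw [hr, ← hi]; exact h, hi'.imp_right ?_⟩
        rintro ⟨a, i', h₁, h₂, h₃⟩
        exact ⟨a, i', h₁, h₂.trans (Nat.lt_succ_self t), h₃⟩
      · obtain ⟨i, hi, -⟩ := ih
        -- The truncation `2 ^ i` was doubled `a + 1` times; the last doubling started from `2 ^ (a
        -- + i)`, for which no set was cheap.
        refine ⟨a + i + 1, ?_, .inr ⟨t, a + i, rfl, Nat.lt_succ_self t, fun T hT => ?_⟩⟩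
        · rw [hr]; refine h.trans ?_; rw [hi]; ring
        · by_contra! hcon
          refine cheapSets_ne_nil hX f c hk (hm t) hT hcon ?_
          rw [← h', hi, pow_add]

end Trace

/-- Over time, the sum of the inverse ranks of the points in their clusters. -/
theorem sum_inv_rank_eq (φ : ℕ → ℕ) (Z : Finset ℕ) (n : ℕ) (h : ∀ j < n, φ j ∈ Z) :
    ∑ t ∈ Finset.range n, (((((Finset.range t).filter (φ · = φ t)).card + 1 : ℕ) : ℚ))⁻¹ =
      ∑ y ∈ Z, harmonic ((Finset.range n).filter (φ · = y)).card := by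
  induction n with
  | zero => simp
  | succ n ih =>
    rw [Finset.sum_range_succ, ih fun j hj => h j (hj.trans (Nat.lt_succ_self n)),
      ← Finset.add_sum_erase Z _ (h n (Nat.lt_succ_self n)),
      ← Finset.add_sum_erase Z _ (h n (Nat.lt_succ_self n))]
    have h₁ : ∀ y ∈ Z.erase (φ n), harmonic ((Finset.range (n + 1)).filter (φ · = y)).card =
        harmonic ((Finset.range n).filter (φ · = y)).card := fun y hy => by
      rw [Finset.range_add_one, Finset.filter_insert, if_neg (Finset.ne_of_mem_erase hy).symm]
    have h₂ : ((Finset.range (n + 1)).filter (φ · = φ n)).card =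
        ((Finset.range n).filter (φ · = φ n)).card + 1 := by
      rw [Finset.range_add_one, Finset.filter_insert, if_pos rfl,
        Finset.card_insert_of_notMem (by simp)]
    rw [Finset.sum_congr rfl h₁, h₂, harmonic_succ]
    ring

/-- The ranks within one cluster are `1, 2, …`, so each cluster contributes a harmonic number. -/
theorem sum_inv_rank_le (φ : ℕ → ℕ) (Z : Finset ℕ) (n : ℕ) (h : ∀ j < n, φ j ∈ Z) :
    ∑ t ∈ Finset.range n, (((((Finset.range t).filter (φ · = φ t)).card + 1 : ℕ) : ℝ))⁻¹ ≤
      Z.card * (1 + Real.log n) := by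
  have h₁ := congrArg (fun q : ℚ => (q : ℝ)) (sum_inv_rank_eq φ Z n h)
  simp only [Rat.cast_sum, Rat.cast_inv, Rat.cast_natCast] at h₁
  rw [h₁, ← nsmul_eq_mul]
  refine Finset.sum_le_card_nsmul _ _ _ fun y _ => (harmonic_le_one_add_log _).trans ?_
  have hc : ((Finset.range n).filter (φ · = y)).card ≤ n :=
    (Finset.card_filter_le _ _).trans (Finset.card_range n).le
  rcases Nat.eq_zero_or_pos ((Finset.range n).filter (φ · = y)).card with h₀ | h₀
  · rw [h₀]; simpa using Real.log_natCast_nonneg n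
  · exact add_le_add_right (Real.log_le_log (by exact_mod_cast h₀) (by exact_mod_cast hc)) 1

/-! ### Potential argument for the recourse -/

section Recourse

variable {X : Type*} [PseudoMetricSpace X]

/-- A point is close to `S` if the center `f i` of its cluster is close to it and many points of
the cluster arrived before. -/
theorem near_le_add_div_rank (f c : ℕ → X) (p : ℕ) (S : Finset ℕ) (φ : ℕ → ℕ) (t : ℕ) {g : ℝ}
    (hu : ∑ j ∈ Finset.range (t + 1), min (p : ℝ) (dist (c j) (f (φ j))) ≤ g)
    (hS : ∑ j ∈ Finset.range t, near f p S (c j) ≤ 2 * g) (hp : (p : ℝ) ≤ 4 * g) :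
    near f p S (c t) ≤ min (p : ℝ) (dist (c t) (f (φ t))) +
      6 * g * (((((Finset.range t).filter (φ · = φ t)).card + 1 : ℕ) : ℝ))⁻¹ := by
  set r := ((Finset.range t).filter (φ · = φ t)).card with hr
  have hu₀ (j : ℕ) : 0 ≤ min (p : ℝ) (dist (c j) (f (φ j))) :=
    le_min (Nat.cast_nonneg p) dist_nonneg
  have hp₀ : (0 : ℝ) ≤ p := Nat.cast_nonneg p
  rcases Nat.eq_zero_or_pos r with h₀ | h₀
  -- The first point of a cluster has nothing to average over; the truncation `p ≤ 4g` alone bounds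
  -- its distance.
  · rw [h₀]
    have := near_le_trunc f p S (c t)
    have := hu₀ t
    norm_num
    linarith
  -- Averaging over the predecessors in the cluster: they pay at most `g` to reach the center and
  -- `2g` to reach `S`. Afterwards `3g/r ≤ 6g/(r+1)` because `r ≥ 1`.
  · have h₁ : (r : ℝ) * near f p S (f (φ t)) ≤ 3 * g := by
      have h₂ : ∀ j ∈ (Finset.range t).filter (φ · = φ t), near f p S (f (φ t)) ≤
          min (p : ℝ) (dist (c j) (f (φ j))) + near f p S (c j) := fun j hj => by
        have := near_le_near_add f p S (f (φ t)) (c j)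
        have hj' : φ j = φ t := (Finset.mem_filter.1 hj).2
        rw [dist_comm] at this
        rwa [hj']
      have h₃ := Finset.card_nsmul_le_sum _ _ _ h₂
      rw [nsmul_eq_mul, ← hr] at h₃
      refine (h₃.trans (Finset.sum_le_sum_of_subset_of_nonneg (Finset.filter_subset _ _)
        fun j _ _ => add_nonneg (hu₀ j) (near_nonneg f p S _))).trans ?_
      rw [Finset.sum_add_distrib]
      rw [Finset.sum_range_succ] at hu
      have := hu₀ t
      linarith
    refine (near_le_near_add f p S (c t) (f (φ t))).trans (add_le_add_right ?_ _)
    have h₀' : (1 : ℝ) ≤ r := by exact_mod_cast h₀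
    have := near_nonneg f p S (f (φ t))
    rw [← div_eq_mul_inv, le_div_iff₀ (by positivity)]
    push_cast
    nlinarith

variable {f c : ℕ → X} {k z : ℕ} {mm : ℕ → ℕ} {S : ℕ → Finset ℕ} {p : ℕ → ℕ}

/-- The indicator of a change of state when the point `t` arrives. -/
noncomputable def changed (S : ℕ → Finset ℕ) (p : ℕ → ℕ) (t : ℕ) : ℝ :=
  open Classical in if S (t + 1) = S t ∧ p (t + 1) = p t then 0 else 1

/-- The indicator of having the wrong number of medians when the point `t` arrives. -/
def forced (k : ℕ) (mm : ℕ → ℕ) (S : ℕ → Finset ℕ) (t : ℕ) : ℕ :=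
  if (S t).card ≠ min k (mm (t + 1)) then 1 else 0

theorem changed_nonneg (S : ℕ → Finset ℕ) (p : ℕ → ℕ) (t : ℕ) : 0 ≤ changed S p t := by
  unfold changed; split_ifs <;> norm_num

theorem changed_le_one (S : ℕ → Finset ℕ) (p : ℕ → ℕ) (t : ℕ) : changed S p t ≤ 1 := by
  unfold changed; split_ifs <;> norm_num

/-- A switch caused by cost takes the potential from above `2g` to at most `g`, which pays `g`. A
forced switch may gain nothing, so `2g` is granted: `g` for the switch and `g` for the new
potential. -/
theorem IsTrace.potential_step (h : IsTrace f c k z mm S p) {g : ℝ} {t : ℕ}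
    (hg : 4 * g = (8 * z + 1) * p (t + 1)) (hp : p t = p (t + 1)) :
    ∑ j ∈ Finset.range (t + 1), near f (p (t + 1)) (S (t + 1)) (c j) + g * changed S p t ≤
      ∑ j ∈ Finset.range t, near f (p (t + 1)) (S t) (c j) +
        near f (p (t + 1)) (S t) (c t) + 2 * g * forced k mm S t := by
  have h₀ : (0 : ℝ) ≤ forced k mm S t := Nat.cast_nonneg _
  have hg₀ : 0 ≤ g := by
    have : (0 : ℝ) ≤ (8 * z + 1) * p (t + 1) := by positivity
    linarith
  rw [← Finset.sum_range_succ]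
  rcases h.keep_or t with ⟨h₁, h₂⟩ | ⟨h₁, h₂⟩
  · rw [changed, if_pos ⟨h₁, h₂⟩, h₁]
    nlinarith
  · have h₃ := changed_le_one S p t
    have h₄ : g * changed S p t ≤ g := mul_le_of_le_one_right hg₀ h₃
    have h₅ : 0 ≤ ∑ j ∈ Finset.range (t + 1), near f (p (t + 1)) (S t) (c j) :=
      Finset.sum_nonneg fun j _ => near_nonneg _ _ _ _
    rcases h₂ with h₂ | h₂ | h₂
    · exact absurd hp.symm h₂
    · rw [forced, if_pos h₂]
      push_cast
      linarith
    · rw [hp] at h₂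
      nlinarith

theorem IsTrace.potential (h : IsTrace f c k z mm S p) {g : ℝ} {P : ℕ}
    (hg : 4 * g = (8 * z + 1) * P) (n : ℕ) :
    ∑ t ∈ Finset.range n, (if p (t + 1) = P then g * changed S p t else 0) +
        (if p n = P then ∑ j ∈ Finset.range n, near f P (S n) (c j) else 0) ≤
      (if P ≤ p n then 2 * g else 0) +
        ∑ t ∈ Finset.range n, (if p t = P ∧ p (t + 1) = P then near f P (S t) (c t) else 0) +
        ∑ t ∈ Finset.range n, (if p (t + 1) = P then 2 * g * forced k mm S t else 0) := by
  have hg₀ : 0 ≤ g := by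
    have : (0 : ℝ) ≤ (8 * z + 1) * P := by positivity
    linarith
  induction n with
  | zero => simp; positivity
  | succ n ih =>
    simp only [Finset.sum_range_succ (n := n)] at ih ⊢
    have hmono : p n ≤ p (n + 1) := h.trunc_mono (Nat.le_succ n)
    have hΦ : 0 ≤ ∑ j ∈ Finset.range n, near f P (S n) (c j) :=
      Finset.sum_nonneg fun j _ => near_nonneg _ _ _ _
    by_cases h₁ : p (n + 1) = P
    · have hF : 0 ≤ 2 * g * (forced k mm S n : ℝ) := by positivity
      rw [if_pos h₁, if_pos h₁, if_pos h₁.ge, if_pos h₁, ← Finset.sum_range_succ]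
      by_cases h₂ : p n = P
      · have h₃ := h.potential_step (g := g) (t := n) (by rw [h₁]; exact hg) (h₂.trans h₁.symm)
        rw [h₁] at h₃
        rw [if_pos h₂, if_pos h₂.ge] at ih
        rw [if_pos ⟨h₂, h₁⟩]
        linarith
      · rw [if_neg h₂, if_neg (show ¬ P ≤ p n by omega)] at ih
        rw [if_neg (fun h' => h₂ h'.1)]
        -- The phase of `P` begins here. The single term `2g` pays for this switch and for the
        -- initial potential, at most `g` each.
        rcases h.keep_or n with h₃ | ⟨h₃, -⟩
        · exact absurd (h₃.2.symm.trans h₁) h₂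
        · rw [h₁] at h₃
          have h₄ : g * changed S p n ≤ g :=
            mul_le_of_le_one_right hg₀ (changed_le_one S p n)
          linarith
    · simp only [h₁, and_false, if_false, add_zero]
      have h₂ : (if P ≤ p n then 2 * g else 0) ≤ if P ≤ p (n + 1) then 2 * g else 0 := by
        split_ifs <;> linarith
      have h₃ : 0 ≤ if p n = P then ∑ j ∈ Finset.range n, near f P (S n) (c j) else 0 := by
        split_ifs <;> first | exact hΦ | exact le_rfl
      linarith

/-- All arrivals of the phase are charged, in hindsight, to one solution `T` that is cheap at the
last step inside the phase. The induction on `n` only serves to locate that step. -/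
theorem IsTrace.sum_increments_le (h : IsTrace f c k z mm S p) (hk : 1 ≤ k)
    (hm : ∀ t, 1 ≤ mm (t + 1)) {g : ℝ} {P : ℕ} (hg : 4 * g = (8 * z + 1) * P) (n : ℕ) :
    ∑ t ∈ Finset.range n, (if p t = P ∧ p (t + 1) = P then near f P (S t) (c t) else 0) ≤
      g + 6 * g * (k * (1 + Real.log n)) := by
  have hg₀ : 0 ≤ g := by
    have : (0 : ℝ) ≤ (8 * z + 1) * P := by positivity
    linarith
  have hPg : (P : ℝ) ≤ 4 * g := by
    have : (0 : ℝ) ≤ z * P := by positivity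
    linarith
  induction n with
  | zero => simp; positivity
  | succ b ih =>
    rw [Finset.sum_range_succ]
    by_cases hb : p b = P ∧ p (b + 1) = P
    · rw [← Finset.sum_range_succ]
      obtain ⟨T, hT, hT'⟩ := h.exists_cheap b
      rw [hb.2, ← hg] at hT'
      choose φ hφ hφ' using exists_infDist_eq f (hT.nonempty hk (hm b))
      have hu : ∑ j ∈ Finset.range (b + 1), min (P : ℝ) (dist (c j) (f (φ (c j)))) ≤ g := by
        simp only [near, hφ'] at hT'
        linarith
      have hterm : ∀ t ∈ Finset.range (b + 1),
          (if p t = P ∧ p (t + 1) = P then near f P (S t) (c t) else 0) ≤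
            min (P : ℝ) (dist (c t) (f (φ (c t)))) + 6 * g *
              (((((Finset.range t).filter fun j => φ (c j) = φ (c t)).card + 1 : ℕ) : ℝ))⁻¹ := by
        intro t ht
        have hu₀ (j : ℕ) : 0 ≤ min (P : ℝ) (dist (c j) (f (φ (c j)))) :=
          le_min (Nat.cast_nonneg P) dist_nonneg
        split_ifs with htP
        · refine near_le_add_div_rank f c P (S t) (fun j => φ (c j)) t ?_ ?_ hPg
          · refine le_trans (Finset.sum_le_sum_of_subset_of_nonneg ?_ fun j _ _ => hu₀ j) hu
            exact Finset.range_mono (Finset.mem_range.1 ht)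
          -- Before the first arrival there is no cost bound to invoke, but the sum is empty.
          · cases t with
            | zero => simpa using hg₀
            | succ t =>
              have := h.cost_le t
              rw [htP.1] at this
              linarith
        · have := hu₀ t
          positivity
      refine (Finset.sum_le_sum hterm).trans ?_
      rw [Finset.sum_add_distrib, ← Finset.mul_sum]
      refine add_le_add hu (mul_le_mul_of_nonneg_left ?_ (by positivity))
      refine (sum_inv_rank_le (fun j => φ (c j)) T (b + 1) fun j _ => hφ (c j)).trans ?_
      refine mul_le_mul_of_nonneg_right (by exact_mod_cast card_le_of_isSolution hT) ?_
      have := Real.log_natCast_nonneg (b + 1)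
      positivity
    · rw [if_neg hb, add_zero]
      refine ih.trans ?_
      have : Real.log b ≤ Real.log (b + 1 : ℕ) := by
        rcases Nat.eq_zero_or_pos b with rfl | hb
        · simp
        · exact Real.log_le_log (by exact_mod_cast hb) (by simp)
      gcongr

/-- The number of changes in the phase of a given truncation. -/
theorem IsTrace.sum_changed_phase_le (h : IsTrace f c k z mm S p) (hk : 1 ≤ k)
    (hm : ∀ t, 1 ≤ mm (t + 1)) {P : ℕ} (hP : 1 ≤ P) (n : ℕ) :
    ∑ t ∈ Finset.range n, (if p (t + 1) = P then changed S p t else 0) ≤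
      3 + 6 * (k * (1 + Real.log n)) +
        2 * ∑ t ∈ Finset.range n, (if p (t + 1) = P then (forced k mm S t : ℝ) else 0) := by
  obtain ⟨g, hg⟩ : ∃ g : ℝ, 4 * g = (8 * z + 1) * P := ⟨(8 * z + 1) * P / 4, by ring⟩
  have hg₀ : 0 < g := by
    have : (1 : ℝ) ≤ P := by exact_mod_cast hP
    have : (0 : ℝ) ≤ z * P := by positivity
    linarith
  have h₁ := h.potential hg n
  have h₂ := h.sum_increments_le hk hm hg n
  have h₃ : 0 ≤ if p n = P then ∑ j ∈ Finset.range n, near f P (S n) (c j) else 0 := by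
    split_ifs
    · exact Finset.sum_nonneg fun j _ => near_nonneg _ _ _ _
    · exact le_rfl
  have h₄ : (if P ≤ p n then 2 * g else 0) ≤ 2 * g := by split_ifs <;> linarith
  have e₁ : ∑ t ∈ Finset.range n, (if p (t + 1) = P then g * changed S p t else 0) =
      g * ∑ t ∈ Finset.range n, (if p (t + 1) = P then changed S p t else 0) := by
    rw [Finset.mul_sum]; exact Finset.sum_congr rfl fun t _ => by split_ifs <;> simp
  have e₂ : ∑ t ∈ Finset.range n, (if p (t + 1) = P then 2 * g * (forced k mm S t : ℝ) else 0) =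
      2 * g * ∑ t ∈ Finset.range n, (if p (t + 1) = P then (forced k mm S t : ℝ) else 0) := by
    rw [Finset.mul_sum]; exact Finset.sum_congr rfl fun t _ => by split_ifs <;> simp
  rw [e₁, e₂] at h₁
  refine le_of_mul_le_mul_left ?_ hg₀
  linarith

/-- Truncations stay below the total distance to one candidate median, up to a constant. -/
theorem IsTrace.exponent_le (h : IsTrace f c k z mm S p) (hk : 1 ≤ k)
    (hm : ∀ t, 1 ≤ mm (t + 1)) {n : ℕ} {D : ℝ} (hnD : 1 ≤ n * D)
    (hd : ∀ j < n, dist (c j) (f 0) ≤ D) {t : ℕ} (ht : t ≤ n) :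
    ∃ i : ℕ, p t = 2 ^ i ∧ (i : ℝ) * Real.log 2 ≤ Real.log (n * D) + 3 * Real.log 2 := by
  have hl₂ : 0 < Real.log 2 := Real.log_pos one_lt_two
  have hlog : 0 ≤ Real.log (n * D) := Real.log_nonneg hnD
  obtain ⟨i, hi, rfl | ⟨a, i', rfl, ha, hT⟩⟩ := h.trunc_eq t
  · exact ⟨0, hi, by push_cast; linarith⟩
  · refine ⟨i' + 1, hi, ?_⟩
    have h₁ := hT _ (isSolution_range k (mm (a + 1)))
    have h₂ := sum_near_range_le (t := a + 1) (p := 2 ^ i') f c hk (hm a)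
    have hD : 0 ≤ D := dist_nonneg.trans (hd a (by omega))
    have h₃ : ∑ j ∈ Finset.range (a + 1), dist (c j) (f 0) ≤ n * D := by
      refine (Finset.sum_le_card_nsmul _ _ D fun j hj =>
        hd j ((Finset.mem_range.1 hj).trans_le (by omega))).trans ?_
      rw [Finset.card_range, nsmul_eq_mul]
      exact mul_le_mul_of_nonneg_right (by exact_mod_cast (by omega : a + 1 ≤ n)) hD
    -- No solution was cheap for `2 ^ i'`, not even one containing candidate `0`, whose total cost
    -- is at most `n * D`.
    have h₄ : (2 : ℝ) ^ i' ≤ 2 ^ 2 * (n * D) := by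
      push_cast at h₁
      have : (0 : ℝ) ≤ z * 2 ^ i' := by positivity
      linarith
    have h₅ := Real.log_le_log (by positivity) h₄
    rw [Real.log_mul (by positivity) (by positivity), Real.log_pow, Real.log_pow] at h₅
    push_cast at h₅ ⊢
    linarith

theorem IsTrace.sum_changed_le (h : IsTrace f c k z mm S p) (hk : 1 ≤ k)
    (hm : ∀ t, 1 ≤ mm (t + 1)) {n L : ℕ} (hL : ∀ t < n, ∃ i < L, p (t + 1) = 2 ^ i)
    (hF : ∑ t ∈ Finset.range n, forced k mm S t ≤ k) :
    ∑ t ∈ Finset.range n, changed S p t ≤ L * (3 + 6 * (k * (1 + Real.log n))) + 2 * k := by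
  have split (a : ℕ → ℝ) : ∑ t ∈ Finset.range n, a t = ∑ i ∈ Finset.range L,
      ∑ t ∈ Finset.range n, if p (t + 1) = 2 ^ i then a t else 0 := by
    rw [Finset.sum_comm]
    refine Finset.sum_congr rfl fun t ht => ?_
    obtain ⟨i, hi, hp⟩ := hL t (Finset.mem_range.1 ht)
    rw [Finset.sum_eq_single i, if_pos hp]
    · exact fun j _ hj => if_neg fun h' => hj
        (Nat.pow_right_injective le_rfl (h'.symm.trans hp))
    · exact fun h' => absurd (Finset.mem_range.2 hi) h'
  have h₁ : ∑ t ∈ Finset.range n, (forced k mm S t : ℝ) ≤ k := by exact_mod_cast hF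
  rw [split] at h₁ ⊢
  refine (Finset.sum_le_sum fun i _ => h.sum_changed_phase_le hk hm Nat.one_le_two_pow n).trans ?_
  rw [Finset.sum_add_distrib, ← Finset.mul_sum, Finset.sum_const, Finset.card_range, nsmul_eq_mul]
  linarith

theorem IsTrace.card_sdiff_le (h : IsTrace f c k z mm S p) (t : ℕ) :
    ((S (t + 1) \ S t).card : ℝ) ≤ k * changed S p t := by
  by_cases h' : S (t + 1) = S t ∧ p (t + 1) = p t
  · simp [h'.1, mul_nonneg, changed_nonneg]
  · rw [changed, if_neg h', mul_one]
    exact_mod_cast (Finset.card_le_card Finset.sdiff_subset).trans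
      (card_le_of_isSolution (h.isSolution t))

theorem IsTrace.recourse_le (h : IsTrace f c k z mm S p) (hk : 1 ≤ k)
    (hm : ∀ t, 1 ≤ mm (t + 1)) {n : ℕ} {D : ℝ} (hn : 2 ≤ n) (hD : 1 ≤ D)
    (hd : ∀ j < n, dist (c j) (f 0) ≤ D) (hF : ∑ t ∈ Finset.range n, forced k mm S t ≤ k) :
    (totalRecourse S n : ℝ) ≤ 200 * (k : ℝ) ^ 2 * Real.log n * Real.log (n * D) := by
  have hn' : (2 : ℝ) ≤ n := by exact_mod_cast hn
  have hk' : (1 : ℝ) ≤ k := by exact_mod_cast hk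
  have hnD : (2 : ℝ) ≤ n * D := by nlinarith
  have hl₂ := Real.log_two_gt_d9
  have ha : Real.log 2 ≤ Real.log n := Real.log_le_log two_pos hn'
  have hb : Real.log 2 ≤ Real.log (n * D) := Real.log_le_log two_pos hnD
  set a := Real.log n
  set b := Real.log (n * D)
  obtain ⟨L, hL, hL'⟩ : ∃ L : ℕ, (L : ℝ) ≤ 8 * b ∧ ∀ t < n, ∃ i < L, p (t + 1) = 2 ^ i := by
    -- Exponents satisfy `i + 1 ≤ b / log 2 + 4 ≤ 5 b / log 2 < 8 b`, as `b ≥ log 2`.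
    refine ⟨⌊8 * b⌋₊, Nat.floor_le (by linarith), fun t ht => ?_⟩
    obtain ⟨i, hi, hi'⟩ := h.exponent_le hk hm (by linarith) hd (t := t + 1) ht
    refine ⟨i, Nat.lt_of_succ_le (Nat.le_floor ?_), hi⟩
    push_cast
    nlinarith
  have h₁ := h.sum_changed_le hk hm hL' hF
  have h₂ : (totalRecourse S n : ℝ) ≤ k * ∑ t ∈ Finset.range n, changed S p t := by
    rw [totalRecourse, Nat.cast_sum, Finset.mul_sum]
    exact Finset.sum_le_sum fun t _ => h.card_sdiff_le t
  have ha' : 1 ≤ 3 / 2 * a := by linarith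
  have hb' : 1 ≤ 3 / 2 * b := by linarith
  have hka : 1 ≤ 3 / 2 * (k * a) := by nlinarith
  have h₃ : 3 + 6 * (k * (1 + a)) ≤ 39 / 2 * (k * a) := by nlinarith
  have h₄ : (L : ℝ) * (3 + 6 * (k * (1 + a))) ≤ 8 * b * (39 / 2 * (k * a)) :=
    mul_le_mul hL h₃ (by nlinarith) (by linarith)
  have h₅ : (1 : ℝ) ≤ 9 / 4 * (a * b) := by nlinarith
  have h₆ : 2 * (k : ℝ) ≤ 9 / 2 * (k * (a * b)) := by nlinarith
  have hab : 0 ≤ (k : ℝ) * (a * b) := by nlinarith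
  calc (totalRecourse S n : ℝ) ≤ k * ∑ t ∈ Finset.range n, changed S p t := h₂
    _ ≤ k * (200 * (k * (a * b))) := mul_le_mul_of_nonneg_left (by linarith) (by linarith)
    _ = _ := by ring

end Recourse

/-! ### Approximation guarantee -/

section Bicriteria

variable {X : Type*} [PseudoMetricSpace X] {f c : ℕ → X} {k z : ℕ} {mm : ℕ → ℕ}
  {S : ℕ → Finset ℕ} {p : ℕ → ℕ}

theorem cost_nonneg (f c : ℕ → X) (C O S : Finset ℕ) : 0 ≤ cost f c C O S :=
  Finset.sum_nonneg fun _ _ => Metric.infDist_nonneg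

theorem opt_nonneg (f c : ℕ → X) (F C : Finset ℕ) (k z : ℕ) : 0 ≤ opt f c F C k z := by
  refine Real.sInf_nonneg ?_
  rintro v ⟨S, O, -, -, -, rfl⟩
  exact cost_nonneg f c C O S

theorem le_opt {m : ℕ} {C : Finset ℕ} {v : ℝ}
    (h : ∀ T O : Finset ℕ, IsSolution (Finset.range m) k T → O.card ≤ z → v ≤ cost f c C O T) :
    v ≤ opt f c (Finset.range m) C k z := by
  refine le_csInf ⟨_, _, ∅, isSolution_range k m, by simp, by simp, rfl⟩ ?_
  rintro w ⟨T, O, hT, -, hO, rfl⟩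
  exact h T O hT hO

/-- The points at distance at least `p` are outliers of a set of medians with small truncated
cost. -/
theorem exists_outliers {f c : ℕ → X} {p t : ℕ} {S : Finset ℕ} (hp : 1 ≤ p)
    (h : 4 * ∑ j ∈ Finset.range t, near f p S (c j) ≤ (16 * z + 2) * p) :
    ∃ O ⊆ Finset.range t, O.card ≤ 4 * z ∧
      2 * cost f c (Finset.range t) O S ≤ (8 * z + 1) * p ∧
      ∀ j ∈ Finset.range t \ O, Metric.infDist (c j) (f '' (S : Set ℕ)) < p := by
  classical
  set O := (Finset.range t).filter fun j => (p : ℝ) ≤ Metric.infDist (c j) (f '' (S : Set ℕ))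
    with hO
  have hout : ∀ j ∈ Finset.range t \ O, Metric.infDist (c j) (f '' (S : Set ℕ)) < p := by
    intro j hj
    simp only [hO, Finset.mem_sdiff, Finset.mem_filter, not_and, not_le] at hj
    exact hj.2 hj.1
  have hsub : O ⊆ Finset.range t := Finset.filter_subset _ _
  have hp' : (1 : ℝ) ≤ p := by exact_mod_cast hp
  refine ⟨O, hsub, ?_, ?_, hout⟩
  · have h₁ : (O.card : ℝ) * p ≤ ∑ j ∈ Finset.range t, near f p S (c j) := by
      rw [← nsmul_eq_mul]
      refine (Finset.card_nsmul_le_sum O (fun j => near f p S (c j)) p fun j hj => ?_).trans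
        (Finset.sum_le_sum_of_subset_of_nonneg hsub fun j _ _ => near_nonneg f p S _)
      exact le_min le_rfl (Finset.mem_filter.1 hj).2
    have h₂ : (4 * O.card : ℝ) ≤ 16 * z + 2 :=
      le_of_mul_le_mul_right (by linarith) (by linarith : (0 : ℝ) < p)
    -- Integrality absorbs the `+ 2`, so that `z = 0` really allows no outlier.
    have h₃ : 4 * O.card ≤ 16 * z + 2 := by exact_mod_cast h₂
    omega
  · have h₁ : cost f c (Finset.range t) O S ≤ ∑ j ∈ Finset.range t, near f p S (c j) := by
      refine le_trans (Finset.sum_le_sum fun j hj => ?_)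
        (Finset.sum_le_sum_of_subset_of_nonneg Finset.sdiff_subset
          fun j _ _ => near_nonneg f p S (c j))
      exact le_min (hout j hj).le le_rfl
    linarith

/-- Each outlier contributes at most `q` to the truncated cost, and there are at most `z` of them.
The factor `2` leaves room for moving `T` to older candidates. -/
theorem sum_near_le_cost {f c : ℕ → X} {q s t : ℕ} (hst : s ≤ t) {T T' O : Finset ℕ}
    (hO : O.card ≤ z) (h : ∀ j < s, j ∉ O →
      Metric.infDist (c j) (f '' (T' : Set ℕ)) ≤ 2 * Metric.infDist (c j) (f '' (T : Set ℕ))) :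
    ∑ j ∈ Finset.range s, near f q T' (c j) ≤ 2 * cost f c (Finset.range t) O T + z * q := by
  classical
  rw [← Finset.sum_sdiff (Finset.inter_subset_left (s₁ := Finset.range s) (s₂ := O)),
    Finset.sdiff_inter_self_left]
  refine add_le_add ?_ ?_
  · rw [cost, Finset.mul_sum]
    refine (Finset.sum_le_sum fun j hj => ?_).trans
      (Finset.sum_le_sum_of_subset_of_nonneg
        (Finset.sdiff_subset_sdiff (Finset.range_mono hst) le_rfl)
        fun j _ _ => mul_nonneg zero_le_two Metric.infDist_nonneg)
    obtain ⟨h₁, h₂⟩ := Finset.mem_sdiff.1 hj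
    exact (near_le_infDist _ _ _ _).trans (h j (Finset.mem_range.1 h₁) h₂)
  · refine (Finset.sum_le_card_nsmul _ _ (q : ℝ) fun j _ => near_le_trunc _ _ _ _).trans ?_
    rw [nsmul_eq_mul]
    refine mul_le_mul_of_nonneg_right ?_ (Nat.cast_nonneg q)
    exact_mod_cast (Finset.card_le_card Finset.inter_subset_right).trans hO

theorem IsTrace.isBicriteria (hX : ∀ x y : X, ∃ a : ℕ, dist x y = (a : ℝ))
    (h : IsTrace f c k z mm S p) (hk : 1 ≤ k) (hm : ∀ t, 1 ≤ mm (t + 1)) (t : ℕ)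
    (hproj : ∀ s ≤ t, ∀ T O : Finset ℕ, IsSolution (Finset.range (mm (t + 1))) k T →
      ∃ T', IsSolution (Finset.range (mm (s + 1))) k T' ∧ ∀ j < s + 1, j ∉ O →
        Metric.infDist (c j) (f '' (T' : Set ℕ)) ≤
          2 * Metric.infDist (c j) (f '' (T : Set ℕ))) :
    IsBicriteria 4 16 f c (Finset.range (mm (t + 1))) (Finset.range (t + 1)) k z (S (t + 1)) := by
  obtain ⟨i, hi, hi'⟩ := h.trunc_eq (t + 1)
  obtain ⟨O, hO, hcard, hcost, hout⟩ :=
    exists_outliers (by rw [hi]; exact Nat.one_le_two_pow) (h.cost_le t)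
  refine ⟨h.isSolution t, O, hO, by exact_mod_cast hcard, ?_⟩
  rcases hi' with rfl | ⟨a, i', rfl, ha, hT⟩
  -- Here the truncation is `1`, and an integer distance below `1` is `0`.
  · have h₀ : cost f c (Finset.range (t + 1)) O (S (t + 1)) = 0 := by
      refine Finset.sum_eq_zero fun j hj => ?_
      have h₁ := hout j hj
      obtain ⟨i, -, h₂⟩ := exists_infDist_eq f ((h.isSolution t).nonempty hk (hm t)) (c j)
      obtain ⟨b, hb⟩ := hX (c j) (f i)
      rw [h₂, hb, hi] at h₁
      have : b < 1 := by exact_mod_cast h₁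
      rw [h₂, hb, Nat.lt_one_iff.1 this, Nat.cast_zero]
    rw [h₀]
    have := opt_nonneg f c (Finset.range (mm (t + 1))) (Finset.range (t + 1)) k z
    linarith
  · have h₁ : cost f c (Finset.range (t + 1)) O (S (t + 1)) / 16 ≤
        opt f c (Finset.range (mm (t + 1))) (Finset.range (t + 1)) k z := by
      refine le_opt fun T O' hT' hO' => ?_
      obtain ⟨T', hsol, hle⟩ := hproj a (by omega) T O' hT'
      -- Write `q = 2 ^ i'`, half the current truncation. Failure at `q` gives `(8z+1)q < 8 cost(T)
      -- + 4zq`, so `(4z+1)q < 8 cost(T)`. The current medians cost at most `(8z+1)q ≤ 2(4z+1)q`,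
      -- whence the factor `16`.
      have h₂ := hT T' hsol
      have h₃ := sum_near_le_cost (f := f) (c := c) (q := 2 ^ i') (t := t + 1) (by omega) hO' hle
      rw [hi, pow_succ] at hcost
      push_cast at hcost h₂ h₃
      have : (0 : ℝ) ≤ z * 2 ^ i' := by positivity
      have : (0 : ℝ) ≤ 2 ^ i' := by positivity
      linarith
    linarith

/-- A solution can be moved to candidate medians among the points of a subset of the points
at the cost of a factor `2`. -/
theorem exists_isSolution_subset (c : ℕ → X) {k s : ℕ} {T : Finset ℕ}
    (hT : T.card ≤ k) (hT₀ : T.Nonempty) (O : Finset ℕ) :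
    ∃ T', IsSolution (Finset.range s) k T' ∧ ∀ j < s, j ∉ O →
      Metric.infDist (c j) (c '' (T' : Set ℕ)) ≤ 2 * Metric.infDist (c j) (c '' (T : Set ℕ)) := by
  classical
  rcases (Finset.range s \ O).eq_empty_or_nonempty with h₀ | h₀
  · refine ⟨_, isSolution_range k s, fun j hj hjO => ?_⟩
    have : j ∈ Finset.range s \ O := Finset.mem_sdiff.2 ⟨Finset.mem_range.2 hj, hjO⟩
    simp [h₀] at this
  -- Replace each median by its nearest non-outlier among the first `s` points. A non-outlier `j`
  -- served by `i` competes for that role, so the detour costs at most `dist (c j) (c i)` again. The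
  -- image is then padded to the required size.
  · have hπ (i : ℕ) := Finset.exists_min_image (Finset.range s \ O) (fun j => dist (c j) (c i)) h₀
    choose π hπ hπ' using hπ
    have hsub : T.image π ⊆ Finset.range s := fun i hi => by
      obtain ⟨a, -, rfl⟩ := Finset.mem_image.1 hi
      exact (Finset.mem_sdiff.1 (hπ a)).1
    have hcard : (T.image π).card ≤ min k s :=
      le_min (Finset.card_image_le.trans hT)
        ((Finset.card_le_card hsub).trans (Finset.card_range s).le)
    obtain ⟨T', h₁, h₂, h₃⟩ := Finset.exists_subsuperset_card_eq hsub hcard (by simp)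
    refine ⟨T', ⟨h₂, by rw [h₃, Finset.card_range]⟩, fun j hj hjO => ?_⟩
    obtain ⟨i, hi, h⟩ := exists_infDist_eq c hT₀ (c j)
    refine (infDist_le_of_mem c (h₁ (Finset.mem_image_of_mem π hi)) (c j)).trans ?_
    have h₄ := hπ' i j (Finset.mem_sdiff.2 ⟨Finset.mem_range.2 hj, hjO⟩)
    have h₅ := dist_triangle_right (c j) (c (π i)) (c i)
    rw [h]
    linarith

end Bicriteria

/-! ### Identifying the online algorithms with the analysed runs -/

section Runs

variable {X : Type*} [PseudoMetricSpace X]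

theorem take_staticHistory (f c : ℕ → X) (m : ℕ) {s t : ℕ} (h : s ≤ t) :
    (staticHistory f c m t).take s = staticHistory f c m s := by
  rw [staticHistory, staticHistory, ← List.map_take, List.take_range, min_eq_left h]

theorem length_staticHistory (f c : ℕ → X) (m t : ℕ) : (staticHistory f c m t).length = t := by
  simp [staticHistory]

/-- The algorithm stores no state: it replays its run on the prefixes of the history, and a prefix
of the history is the history at the earlier time. -/
theorem staticState_staticHistory (f c : ℕ → X) (k z m : ℕ) {s t : ℕ} (h : s ≤ t) :
    staticState (k, z, m, staticHistory f c m t) s = runState f c k z (fun _ => m) s := by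
  induction s with
  | zero => rfl
  | succ s ih =>
    rw [runState_succ, ← ih (by omega), ← take_staticHistory f c m h]
    rfl

theorem staticRun_staticAlg (f c : ℕ → X) (k z m : ℕ) :
    staticRun staticAlg f c k z m = fun t => (runState f c k z (fun _ => m) t).1.toFinset := by
  funext t
  rw [staticRun]
  split_ifs with h
  · simp [h, runState]
  · simp only [staticAlg, length_staticHistory, staticState_staticHistory f c k z m le_rfl]

theorem length_dynamicHistory (c : ℕ → X) (t : ℕ) : (dynamicHistory c t).length = t := by
  simp [dynamicHistory]

theorem getD_dynamicHistory (c : ℕ → X) {i j t : ℕ} (h : j < t) :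
    ((dynamicHistory c t).getD j []).getD i 0 = if i < j then ⌊dist (c i) (c j)⌋₊ else 0 := by
  have hrow : (dynamicHistory c t).getD j [] =
      (List.range j).map fun i => ⌊dist (c i) (c j)⌋₊ := by
    rw [dynamicHistory, List.getD_eq_getElem _ _ (by simpa using h)]
    simp
  rw [hrow]
  split_ifs with hi
  · rw [List.getD_eq_getElem _ _ (by simpa using hi)]
    simp
  · exact List.getD_eq_default _ _ (by simpa using hi)

/-- For `i ≠ j` the distance is recorded only in the row of the later point and the other lookup
defaults to `0`, so the sum of both is the distance. On the diagonal both default to `0`. -/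
theorem symmMatrix_dynamicHistory (c : ℕ → X) {s t : ℕ} (h : s ≤ t) :
    symmMatrix (dynamicHistory c t) s = staticHistory c c s s := by
  refine List.map_congr_left fun j hj => List.map_congr_left fun i hi => ?_
  rw [List.mem_range] at hi hj
  rw [getD_dynamicHistory c (hj.trans_le h), getD_dynamicHistory c (hi.trans_le h)]
  rcases lt_trichotomy i j with hij | rfl | hij
  · simp [hij, hij.not_gt]
  · simp
  · simp [hij, hij.not_gt, dist_comm]

theorem dynamicState_dynamicHistory (c : ℕ → X) (k z : ℕ) {s t : ℕ} (h : s ≤ t) :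
    dynamicState (k, z, dynamicHistory c t) s = runState c c k z id s := by
  induction s with
  | zero => rfl
  | succ s ih =>
    rw [runState_succ, ← ih (by omega), id, ← symmMatrix_dynamicHistory c h]
    rfl

theorem dynamicRun_dynamicAlg (c : ℕ → X) (k z : ℕ) :
    dynamicRun dynamicAlg c k z = fun t => (runState c c k z id t).1.toFinset := by
  funext t
  rw [dynamicRun]
  split_ifs with h
  · simp [h, runState]
  · simp only [dynamicAlg, length_dynamicHistory, dynamicState_dynamicHistory c k z le_rfl]

/-- Integrality: if the diameter were below `1`, all distances would be `0`. -/
theorem one_le_diam (hX : ∀ x y : X, ∃ a : ℕ, dist x y = (a : ℝ)) {s : Set X} (hs : s.Finite)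
    (h : 0 < Metric.diam s) : 1 ≤ Metric.diam s := by
  by_contra! hlt
  refine h.not_ge (Metric.diam_le_of_forall_dist_le le_rfl fun x hx y hy => ?_)
  have h₁ := Metric.dist_le_diam_of_mem hs.isBounded hx hy
  obtain ⟨a, ha⟩ := hX x y
  rw [ha] at h₁ ⊢
  have h₂ : a < 1 := by exact_mod_cast h₁.trans_lt hlt
  rw [Nat.lt_one_iff.1 h₂, Nat.cast_zero]

/-- If the number of medians is right from some time on, it is wrong at few times. -/
theorem sum_forced_le {k n : ℕ} {mm : ℕ → ℕ} {S : ℕ → Finset ℕ}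
    (h : ∀ t, k ≤ t → (S t).card = min k (mm (t + 1))) :
    ∑ t ∈ Finset.range n, forced k mm S t ≤ k := by
  simp only [forced]
  rw [← Finset.card_filter]
  refine (Finset.card_le_card fun t ht => ?_).trans (Finset.card_range k).le
  rw [Finset.mem_filter] at ht
  rw [Finset.mem_range]
  by_contra! hkt
  exact ht.2 (h t hkt)

end Runs

end KMedOutliers

theorem mainTheorem2 :
    ∃ β α K : ℝ, 1 ≤ β ∧ 1 ≤ α ∧ 0 < K ∧
      -- static `F`: the `m` candidate medians are fixed in advance
      (∃ A : ℕ × ℕ × ℕ × List (List ℕ) → List ℕ, Computable A ∧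
        ∀ (X : Type*) [PseudoMetricSpace X], (∀ x y : X, ∃ a : ℕ, dist x y = (a : ℝ)) →
        ∀ (f c : ℕ → X) (k z m n : ℕ), 1 ≤ k → 1 ≤ m →
          (∀ t : ℕ, 1 ≤ t → t ≤ n →
            KMedOutliers.IsBicriteria β α f c (Finset.range m) (Finset.range t) k z
              (KMedOutliers.staticRun A f c k z m t)) ∧
          (2 ≤ n → 0 < Metric.diam (f '' Set.Iio m ∪ c '' Set.Iio n) →
            (KMedOutliers.totalRecourse (KMedOutliers.staticRun A f c k z m) n : ℝ) ≤
              K * (k : ℝ) ^ 2 * Real.log n *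
                Real.log (n * Metric.diam (f '' Set.Iio m ∪ c '' Set.Iio n)))) ∧
      -- `F = C`: the candidate medians are the points that have arrived
      (∃ A : ℕ × ℕ × List (List ℕ) → List ℕ, Computable A ∧
        ∀ (X : Type*) [PseudoMetricSpace X], (∀ x y : X, ∃ a : ℕ, dist x y = (a : ℝ)) →
        ∀ (c : ℕ → X) (k z n : ℕ), 1 ≤ k →
          (∀ t : ℕ, 1 ≤ t → t ≤ n →
            KMedOutliers.IsBicriteria β α c c (Finset.range t) (Finset.range t) k z
              (KMedOutliers.dynamicRun A c k z t)) ∧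
          (2 ≤ n → 0 < Metric.diam (c '' Set.Iio n) →
            (KMedOutliers.totalRecourse (KMedOutliers.dynamicRun A c k z) n : ℝ) ≤
              K * (k : ℝ) ^ 2 * Real.log n *
                Real.log (n * Metric.diam (c '' Set.Iio n)))) := by
  open KMedOutliers in
  refine ⟨4, 16, 200, by norm_num, by norm_num, by norm_num,
    ⟨staticAlg, primrec_staticAlg.to_comp, ?_⟩, ⟨dynamicAlg, primrec_dynamicAlg.to_comp, ?_⟩⟩
  · intro X _ hX f c k z m n hk hm
    have htr := isTrace_runState hX f c z (mm := fun _ => m) hk monotone_const fun _ => hm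
    rw [staticRun_staticAlg]
    refine ⟨fun t ht _ => ?_, fun hn hD => ?_⟩
    · obtain ⟨t, rfl⟩ := Nat.exists_eq_add_of_le' ht
      exact htr.isBicriteria hX hk (fun _ => hm) t fun s _ T O hT =>
        ⟨T, hT, fun j _ _ => le_mul_of_one_le_left Metric.infDist_nonneg one_le_two⟩
    · have hfin : (f '' Set.Iio m ∪ c '' Set.Iio n).Finite :=
        ((Set.finite_Iio m).image f).union ((Set.finite_Iio n).image c)
      refine htr.recourse_le hk (fun _ => hm) hn (one_le_diam hX hfin hD) (fun j hj => ?_)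
        (sum_forced_le fun t ht => ?_)
      · exact Metric.dist_le_diam_of_mem hfin.isBounded (.inr ⟨j, hj, rfl⟩) (.inl ⟨0, hm, rfl⟩)
      · obtain ⟨t, rfl⟩ := Nat.exists_eq_add_of_le' (hk.trans ht)
        rw [(htr.isSolution t).2, Finset.card_range]
  · intro X _ hX c k z n hk
    have hm (t : ℕ) : 1 ≤ id (t + 1) := Nat.le_add_left 1 t
    have htr := isTrace_runState hX c c z (mm := id) hk monotone_id hm
    rw [dynamicRun_dynamicAlg]
    refine ⟨fun t ht _ => ?_, fun hn hD => ?_⟩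
    · obtain ⟨t, rfl⟩ := Nat.exists_eq_add_of_le' ht
      exact htr.isBicriteria hX hk hm t fun s _ T O hT =>
        exists_isSolution_subset c (card_le_of_isSolution hT) (hT.nonempty hk (hm t)) O
    · have hfin : (c '' Set.Iio n).Finite := (Set.finite_Iio n).image c
      refine htr.recourse_le hk hm hn (one_le_diam hX hfin hD) (fun j hj => ?_)
        (sum_forced_le fun t ht => ?_)
      · exact Metric.dist_le_diam_of_mem hfin.isBounded ⟨j, hj, rfl⟩
          ⟨0, show 0 < n by omega, rfl⟩
      · obtain ⟨t, rfl⟩ := Nat.exists_eq_add_of_le' (hk.trans ht)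
        rw [(htr.isSolution t).2, Finset.card_range]
        -- Once `k` points have arrived, both `min k t` and `min k (t + 1)` equal `k`.
        simp only [id]
        omega
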